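/- Let $G$ be a compact, connected Lie group with Lie algebra $\mathfrak g$, and identify $\mathfrak g^*\cong\mathfrak g$ by a fixed $\mathrm{Ad}$-invariant inner product $\langle\cdot,\cdot\rangle$. For a smooth $G$-manifold $W$ (possibly with boundary), $\xi\in\mathfrak g$ and a map $\phi:W\to\mathfrak g$, let $$\xi^W(w)=\tfrac{d}{dt}\big|_{t=0}\exp(-t\xi)\cdot w,\qquad X^\phi(w)=\tfrac{d}{dt}\big|_{t=0}\exp(-t\phi(w))\cdot w .$$ The map $\phi$ is called *taming* (over an invariant open set $S \subseteq W$) if the set of zeroes of $X^\phi$ (in $S$) is compact. Let $(M,\omega)$ be a Hamiltonian $G$-space with equivariant moment map $\mu^E:M\to\mathfrak g$, and let $E\to M$ be a pre-quantum line bundle: a $G$-equivariant Hermitian line bundle with a $G$-invariant Hermitian connection $\nabla^E$ such that $\frac{\sqrt{-1}}{2\pi}(\nabla^E)^2=\omega$ and such that the Kostant formula $$2\pi\sqrt{-1}\,\langle\mu^E,\xi\rangle=\nabla^E_{\xi^M}-\mathcal L^E_\xi\qquad(\xi\in\mathfrak g)$$ holds, where $\mathcal L^E_\xi$ is the Lie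 derivative of sections of $E$. Let $J$ be a $G$-invariant almost complex structure on $M$ such that $g(X,Y)=\omega(X,JY)$ is a Riemannian metric. Let $N$ be a compact Hamiltonian $G$-space with pre-quantum line bundle $F$ and moment map $\mu^F:N\to\mathfrak g$, in the same sense. Let $U\subseteq M$ be a $G$-invariant, open, relatively compact subset such that $\mu^E$ is taming over $U$, and let $V$ be a $G$-invariant, relatively compact neighbourhood of $\{X^{\mu^E}=0\}\cap U$ with $\overline V\subset U$. Let $\chi$ be a smooth $G$-invariant real function on $U$, and let $\mu^E_\chi:U\to\mathfrak g$ be the map determined through the Kostant formula by the connection $\nabla^E+2\pi\sqrt{-1}\,\chi\cdot g(X^{\mu^E},\cdot)$ on $E|_U$. Suppose that $\chi$ is chosen so that (1) $\mu^E_\chi$ is proper; (2) $\mu^E_\chi|_V=\mu^E|_V$; (3) $\|\mu^E_\chi\|\ge\|\mu^E|_U\|$; (4) $X^{\mu^E}|_U$ and $X^{\mu^E_\chi}$ have the same zeroes. Let $\eta\in C^\infty(\mathbb R)$ have values in $[0,1]$, with $\eta(t)=0$ for $t\le 1/3$ and $\eta(t)=1$ for $t\ge 2/3$. Let $G$ act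 on $U\times N\times[0,1]$ diagonally on the first two factors and trivially on the third. Then the map $$\phi:U\times N\times[0,1]\to\mathfrak g,\qquad \phi(m,n,t)=\mu^E_\chi(m)+\eta(t)\,\mu^F(n),$$ is taming, i.e. the set of zeroes of $X^\phi$ in $U\times N\times[0,1]$ is compact. -/

import Mathlib

open Set Bundle
open scoped Manifold ContDiff Topology

noncomputable section

namespace PreQuant

/-! ### Lie group actions -/

section Actions

variable {EG : Type*} [NormedAddCommGroup EG] [NormedSpace ℝ EG]
  {G : Type*} [TopologicalSpace G] [ChartedSpace EG G] [Group G]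

/-- The Lie algebra of `G`, the tangent space at the identity. -/
abbrev LieAlg (EG : Type*) [NormedAddCommGroup EG] [NormedSpace ℝ EG]
    (G : Type*) [TopologicalSpace G] [ChartedSpace EG G] [Group G] : Type _ :=
  GroupLieAlgebra 𝓘(ℝ, EG) G

/-- The adjoint action of `g` on the Lie algebra: the derivative at `1` of `h ↦ g h g⁻¹`. -/
def Ad (g : G) (ξ : LieAlg EG G) : LieAlg EG G :=
  mfderiv 𝓘(ℝ, EG) 𝓘(ℝ, EG) (fun h : G => g * h * g⁻¹) 1 ξ

/-- `B` is an `Ad`-invariant inner product on the Lie algebra of `G`. -/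
structure IsAdInvariantInner (B : LieAlg EG G →L[ℝ] LieAlg EG G →L[ℝ] ℝ) : Prop where
  symm : ∀ ξ ζ, B ξ ζ = B ζ ξ
  pos : ∀ ξ, ξ ≠ 0 → 0 < B ξ ξ
  invariant : ∀ (g : G) (ξ ζ : LieAlg EG G), B (Ad g ξ) (Ad g ζ) = B ξ ζ

variable {EW HW : Type*} [NormedAddCommGroup EW] [NormedSpace ℝ EW] [TopologicalSpace HW]
  {W : Type*} [TopologicalSpace W] [ChartedSpace HW W]

/-- The vector field `ξ^W` of the infinitesimal action of `ξ`, for an action `a` of `G` on `W`: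
`ξ^W(w) = d/dt|₀ exp(-tξ) · w`, that is, minus the derivative at `1` of the orbit map `g ↦ g · w`
in the direction `ξ` (the velocity of `exp(-tξ)` at `t = 0` being `-ξ`). -/
def actionField (IW : ModelWithCorners ℝ EW HW) (a : G → W → W) (ξ : LieAlg EG G) (w : W) :
    TangentSpace IW w :=
  -(mfderiv 𝓘(ℝ, EG) IW (fun g : G => a g w) 1 ξ)

/-- The vector field `X^φ(w) = d/dt|₀ exp(-t φ(w)) · w` induced by a Lie algebra valued map. -/
def inducedField (IW : ModelWithCorners ℝ EW HW) (a : G → W → W) (φ : W → LieAlg EG G) (w : W) :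
    TangentSpace IW w :=
  actionField IW a (φ w) w

/-- `φ` is taming over the open invariant set `S`: the vanishing set of `X^φ` in `S` is compact.
Only the values of `φ` on `S` matter. -/
def IsTamingOn (IW : ModelWithCorners ℝ EW HW) (a : G → W → W) (φ : W → LieAlg EG G)
    (S : Set W) : Prop :=
  IsCompact {w | w ∈ S ∧ inducedField IW a φ w = 0}

/-- A set is invariant under the group action. -/
def IsInvariantSet (G : Type*) [Group G] {M : Type*} [MulAction G M] (S : Set M) : Prop :=
  ∀ (g : G), ∀ x ∈ S, g • x ∈ S

end Actions

/-! ### Hamiltonian spaces -/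

section Hamiltonian

variable {EG : Type*} [NormedAddCommGroup EG] [NormedSpace ℝ EG]
  {G : Type*} [TopologicalSpace G] [ChartedSpace EG G] [Group G]
  {EM : Type*} [NormedAddCommGroup EM] [NormedSpace ℝ EM]
  {M : Type*} [TopologicalSpace M] [ChartedSpace EM M] [IsManifold 𝓘(ℝ, EM) ∞ M] [MulAction G M]

/-- The tangent map of the action of `g` at `x`. -/
def tangentAct (EM : Type*) [NormedAddCommGroup EM] [NormedSpace ℝ EM]
    {M : Type*} [TopologicalSpace M] [ChartedSpace EM M] [MulAction G M] (g : G) (x : M) :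
    TangentSpace 𝓘(ℝ, EM) x →L[ℝ] TangentSpace 𝓘(ℝ, EM) (g • x) :=
  mfderiv 𝓘(ℝ, EM) 𝓘(ℝ, EM) (fun y : M => g • y) x

/-- A smooth vector field on `M`. -/
def IsSmoothField (X : Π x : M, TangentSpace 𝓘(ℝ, EM) x) : Prop :=
  ContMDiff 𝓘(ℝ, EM) (𝓘(ℝ, EM).prod 𝓘(ℝ, EM)) ∞
    (fun x => TotalSpace.mk' EM (E := fun x : M => TangentSpace 𝓘(ℝ, EM) x) x (X x))

/-- The directional derivative `X f` of a real function along a vector field. -/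
def dirDeriv (f : M → ℝ) (X : Π x : M, TangentSpace 𝓘(ℝ, EM) x) (x : M) : ℝ :=
  mfderiv 𝓘(ℝ, EM) 𝓘(ℝ, ℝ) f x (X x)

/-- A symplectic form: a smooth, alternating, nondegenerate, closed two-form. Closedness is
`dΩ = 0`, with `dΩ(X, Y, Z)` written by the invariant formula for the exterior derivative. -/
structure IsSymplecticForm
    (Ω : Π x : M, TangentSpace 𝓘(ℝ, EM) x →L[ℝ] TangentSpace 𝓘(ℝ, EM) x →L[ℝ] ℝ) : Prop where
  smooth : ContMDiff 𝓘(ℝ, EM) (𝓘(ℝ, EM).prod 𝓘(ℝ, EM →L[ℝ] EM →L[ℝ] ℝ)) ∞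
    (fun x => TotalSpace.mk' (EM →L[ℝ] EM →L[ℝ] ℝ)
      (E := fun x : M => TangentSpace 𝓘(ℝ, EM) x →L[ℝ] TangentSpace 𝓘(ℝ, EM) x →L[ℝ] ℝ) x (Ω x))
  alternating : ∀ x v, Ω x v v = 0
  nondegenerate : ∀ x v, (∀ w, Ω x v w = 0) → v = 0
  closed : ∀ X Y Z : Π x : M, TangentSpace 𝓘(ℝ, EM) x,
    IsSmoothField X → IsSmoothField Y → IsSmoothField Z → ∀ x,
      dirDeriv (fun y => Ω y (Y y) (Z y)) X x - dirDeriv (fun y => Ω y (X y) (Z y)) Y x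
        + dirDeriv (fun y => Ω y (X y) (Y y)) Z x
        - Ω x (VectorField.mlieBracket 𝓘(ℝ, EM) X Y x) (Z x)
        + Ω x (VectorField.mlieBracket 𝓘(ℝ, EM) X Z x) (Y x)
        - Ω x (VectorField.mlieBracket 𝓘(ℝ, EM) Y Z x) (X x) = 0

/-- `(M, Ω)` with the action of `G` is a Hamiltonian space with moment map `μ`. The moment map takes
values in the Lie algebra, identified with its dual by the inner product `B`; its component along
`ξ` is `μ_ξ = B μ ξ`. -/
structure IsHamiltonian (B : LieAlg EG G →L[ℝ] LieAlg EG G →L[ℝ] ℝ)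
    (Ω : Π x : M, TangentSpace 𝓘(ℝ, EM) x →L[ℝ] TangentSpace 𝓘(ℝ, EM) x →L[ℝ] ℝ)
    (μ : M → LieAlg EG G) : Prop where
  symplectic : IsSymplecticForm Ω
  invariant : ∀ (g : G) (x : M) (v w : TangentSpace 𝓘(ℝ, EM) x),
    Ω (g • x) (tangentAct EM g x v) (tangentAct EM g x w) = Ω x v w
  smooth : ContMDiff 𝓘(ℝ, EM) 𝓘(ℝ, EG) ∞ (M' := EG) μ
  equivariant : ∀ (g : G) (x : M), μ (g • x) = Ad g (μ x)
  /-- `dμ_ξ = Ω(ξ^M, ·)`. -/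
  hamilton : ∀ (ξ : LieAlg EG G) (x : M) (v : TangentSpace 𝓘(ℝ, EM) x),
    mfderiv 𝓘(ℝ, EM) 𝓘(ℝ, ℝ) (fun y => B (μ y) ξ) x v =
      Ω x (actionField 𝓘(ℝ, EM) (fun (g : G) (y : M) => g • y) ξ x) v

/-- `J` is a `G`-invariant smooth almost complex structure for which `Ω(X, JY)` is the
Riemannian metric `g`. -/
structure IsCompatible (G : Type*) [Group G] [MulAction G M]
    (Ω : Π x : M, TangentSpace 𝓘(ℝ, EM) x →L[ℝ] TangentSpace 𝓘(ℝ, EM) x →L[ℝ] ℝ)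
    (J : Π x : M, TangentSpace 𝓘(ℝ, EM) x →L[ℝ] TangentSpace 𝓘(ℝ, EM) x)
    (g : ContMDiffRiemannianMetric 𝓘(ℝ, EM) ∞ EM (fun x : M => TangentSpace 𝓘(ℝ, EM) x)) :
    Prop where
  smooth : ContMDiff 𝓘(ℝ, EM) (𝓘(ℝ, EM).prod 𝓘(ℝ, EM →L[ℝ] EM)) ∞
    (fun x => TotalSpace.mk' (EM →L[ℝ] EM)
      (E := fun x : M => TangentSpace 𝓘(ℝ, EM) x →L[ℝ] TangentSpace 𝓘(ℝ, EM) x) x (J x))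
  sq : ∀ x v, J x (J x v) = -v
  invariant : ∀ (h : G) (x : M) (v : TangentSpace 𝓘(ℝ, EM) x),
    J (h • x) (tangentAct EM h x v) = tangentAct EM h x (J x v)
  metric : ∀ (x : M) (v w : TangentSpace 𝓘(ℝ, EM) x), g.inner x v w = Ω x v (J x w)

end Hamiltonian

/-! ### Pre-quantum line bundles

A smooth Hermitian line bundle is a family `E` of one-dimensional complex inner product spaces with
local trivialisations in `ℂ` that are complex linear on the fibres and smooth in the base point. -/

section LineBundle

variable {EG : Type*} [NormedAddCommGroup EG] [NormedSpace ℝ EG]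
  {G : Type*} [TopologicalSpace G] [ChartedSpace EG G] [Group G]
  {EM : Type*} [NormedAddCommGroup EM] [NormedSpace ℝ EM]
  {M : Type*} [TopologicalSpace M] [ChartedSpace EM M] [IsManifold 𝓘(ℝ, EM) ∞ M] [MulAction G M]
  {E : M → Type*} [TopologicalSpace (TotalSpace ℂ E)]
  [∀ x, NormedAddCommGroup (E x)] [∀ x, InnerProductSpace ℂ (E x)]
  [FiberBundle ℂ E] [VectorBundle ℂ ℂ E] [VectorBundle ℝ ℂ E]
  [ContMDiffVectorBundle ∞ ℂ E 𝓘(ℝ, EM)]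

/-- A section is smooth on `S`. -/
def IsSmoothSectionOn (EM : Type*) [NormedAddCommGroup EM] [NormedSpace ℝ EM]
    {M : Type*} [TopologicalSpace M] [ChartedSpace EM M]
    {E : M → Type*} [TopologicalSpace (TotalSpace ℂ E)]
    [∀ x, NormedAddCommGroup (E x)] [∀ x, InnerProductSpace ℂ (E x)] [FiberBundle ℂ E]
    (s : Π x : M, E x) (S : Set M) : Prop :=
  ContMDiffOn 𝓘(ℝ, EM) (𝓘(ℝ, EM).prod 𝓘(ℝ, ℂ)) ∞ (fun x => TotalSpace.mk' ℂ x (s x)) S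

/-- A lift of the action of `G` on `M` to a smooth action on the Hermitian line bundle `E` by
complex linear isometries between the fibres. -/
structure BundleAction (EG : Type*) [NormedAddCommGroup EG] [NormedSpace ℝ EG]
    (G : Type*) [TopologicalSpace G] [ChartedSpace EG G] [Group G]
    (EM : Type*) [NormedAddCommGroup EM] [NormedSpace ℝ EM]
    {M : Type*} [TopologicalSpace M] [ChartedSpace EM M] [MulAction G M]
    (E : M → Type*) [TopologicalSpace (TotalSpace ℂ E)]
    [∀ x, NormedAddCommGroup (E x)] [∀ x, InnerProductSpace ℂ (E x)] [FiberBundle ℂ E] where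
  act : Π (g : G) (x : M), E x →ₗ[ℂ] E (g • x)
  one_act : ∀ (x : M) (v : E x),
    TotalSpace.mk' ℂ ((1 : G) • x) (act 1 x v) = TotalSpace.mk' ℂ x v
  mul_act : ∀ (g h : G) (x : M) (v : E x),
    TotalSpace.mk' ℂ ((g * h) • x) (act (g * h) x v) =
      TotalSpace.mk' ℂ (g • h • x) (act g (h • x) (act h x v))
  smooth : ContMDiff (𝓘(ℝ, EG).prod (𝓘(ℝ, EM).prod 𝓘(ℝ, ℂ))) (𝓘(ℝ, EM).prod 𝓘(ℝ, ℂ)) ∞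
    (fun p : G × TotalSpace ℂ E => TotalSpace.mk' ℂ (p.1 • p.2.1) (act p.1 p.2.1 p.2.2))
  isometry : ∀ (g : G) (x : M) (v w : E x), inner ℂ (act g x v) (act g x w) = inner ℂ v w

/-- The action of `g` on sections: `(g · s)(x) = g · s(g⁻¹ x)`. -/
def BundleAction.translate (ρ : BundleAction EG G EM E) (g : G) (s : Π x : M, E x) (x : M) : E x :=
  (smul_inv_smul g x) ▸ ρ.act g (g⁻¹ • x) (s (g⁻¹ • x))

/-- The Lie derivative of sections: `(𝓛_ξ s)(x) = d/dt|₀ exp(tξ) · s(exp(-tξ) x)`, that is, the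
derivative at `1` in the direction `ξ` of the map `g ↦ (g · s)(x)` from `G` to the fibre at `x`. -/
def BundleAction.lieDeriv (ρ : BundleAction EG G EM E) (ξ : LieAlg EG G) (s : Π x : M, E x)
    (x : M) : E x :=
  mfderiv 𝓘(ℝ, EG) 𝓘(ℝ, E x) (fun g : G => ρ.translate g s x) 1 ξ

/-- `E` with the lifted action `ρ` and the connection `nabla` is a pre-quantum line bundle
for `Ω`: the metric on the fibres is smooth, `nabla` is a smooth, `G`-invariant, Hermitian
connection on the complex line bundle, and `(√-1 / 2π) nabla² = Ω`. -/
structure IsPrequantum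
    (Ω : Π x : M, TangentSpace 𝓘(ℝ, EM) x →L[ℝ] TangentSpace 𝓘(ℝ, EM) x →L[ℝ] ℝ)
    (ρ : BundleAction EG G EM E) (nabla : CovariantDerivative 𝓘(ℝ, EM) ℂ E) : Prop where
  metric_smooth : ∀ s t : Π x : M, E x,
    IsSmoothSectionOn EM s univ → IsSmoothSectionOn EM t univ →
      ContMDiff 𝓘(ℝ, EM) 𝓘(ℝ, ℂ) ∞ (fun x => inner ℂ (s x) (t x))
  /-- `nabla_X s` is smooth for smooth `X` and `s`. -/
  smooth : ∀ (X : Π x : M, TangentSpace 𝓘(ℝ, EM) x) (s : Π x : M, E x),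
    IsSmoothField X → IsSmoothSectionOn EM s univ →
      IsSmoothSectionOn EM (fun x => nabla s x (X x)) univ
  complex_linear : ∀ (c : ℂ) (s : Π x : M, E x), IsSmoothSectionOn EM s univ →
    ∀ (x : M) (v : TangentSpace 𝓘(ℝ, EM) x), nabla (fun y => c • s y) x v = c • nabla s x v
  hermitian : ∀ s t : Π x : M, E x,
    IsSmoothSectionOn EM s univ → IsSmoothSectionOn EM t univ →
      ∀ (x : M) (v : TangentSpace 𝓘(ℝ, EM) x),
        mfderiv 𝓘(ℝ, EM) 𝓘(ℝ, ℂ) (fun y => inner ℂ (s y) (t y)) x v =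
          inner ℂ (nabla s x v) (t x) + inner ℂ (s x) (nabla t x v)
  invariant : ∀ (g : G) (s : Π x : M, E x), IsSmoothSectionOn EM s univ →
    ∀ (x : M) (v : TangentSpace 𝓘(ℝ, EM) x),
      nabla (ρ.translate g s) (g • x) (tangentAct EM g x v) = ρ.act g x (nabla s x v)
  curvature : ∀ (X Y : Π x : M, TangentSpace 𝓘(ℝ, EM) x) (s : Π x : M, E x),
    IsSmoothField X → IsSmoothField Y → IsSmoothSectionOn EM s univ → ∀ x : M,
      (Complex.I / (2 * Real.pi)) •
        (nabla (fun y => nabla s y (Y y)) x (X x) - nabla (fun y => nabla s y (X y)) x (Y x)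
          - nabla s x (VectorField.mlieBracket 𝓘(ℝ, EM) X Y x)) =
        ((Ω x (X x) (Y x) : ℝ) : ℂ) • s x

/-- `μ` is, on the open invariant set `S`, the moment map determined by the connection `nabla`
on `E` over `S` through the Kostant formula `2π√-1 μ_ξ = nabla_{ξ^M} - 𝓛_ξ`. -/
def IsKostantMomentOn (B : LieAlg EG G →L[ℝ] LieAlg EG G →L[ℝ] ℝ) (ρ : BundleAction EG G EM E)
    (nabla : (Π x : M, E x) → (Π x : M, TangentSpace 𝓘(ℝ, EM) x →L[ℝ] E x))
    (S : Set M) (μ : M → LieAlg EG G) : Prop :=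
  ∀ (ξ : LieAlg EG G) (s : Π x : M, E x), IsSmoothSectionOn EM s S → ∀ x ∈ S,
    (2 * Real.pi * Complex.I * ((B (μ x) ξ : ℝ) : ℂ)) • s x =
      nabla s x (actionField 𝓘(ℝ, EM) (fun (g : G) (y : M) => g • y) ξ x) - ρ.lieDeriv ξ s x

/-- The deformed connection `nabla + 2π√-1 χ (X^μ)^*`, where `(X^μ)^*` is the one-form dual to
`X^μ` for the Riemannian metric `g`. -/
def deformedConnection
    (g : ContMDiffRiemannianMetric 𝓘(ℝ, EM) ∞ EM (fun x : M => TangentSpace 𝓘(ℝ, EM) x))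
    (nabla : CovariantDerivative 𝓘(ℝ, EM) ℂ E) (μ : M → LieAlg EG G) (χ : M → ℝ)
    (s : Π x : M, E x) (x : M) : TangentSpace 𝓘(ℝ, EM) x →L[ℝ] E x :=
  nabla s x +
    (g.inner x (inducedField 𝓘(ℝ, EM) (fun (h : G) (y : M) => h • y) μ x)).smulRight
      ((2 * Real.pi * Complex.I * (χ x : ℂ)) • s x)

/-- The choice of `V` and `χ` over the open set `U`, where `μχ : U → 𝔤` is the moment map determined
by the connection deformed by `χ`. Only the values of `χ` and `μχ` on `U` matter. -/
structure IsProperDeformation (B : LieAlg EG G →L[ℝ] LieAlg EG G →L[ℝ] ℝ)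
    (g : ContMDiffRiemannianMetric 𝓘(ℝ, EM) ∞ EM (fun x : M => TangentSpace 𝓘(ℝ, EM) x))
    (ρ : BundleAction EG G EM E) (nabla : CovariantDerivative 𝓘(ℝ, EM) ℂ E)
    (μ : M → LieAlg EG G) (U V : Set M) (χ : M → ℝ) (μχ : M → LieAlg EG G) : Prop where
  invariant_V : IsInvariantSet G V
  nhds_V : {x | x ∈ U ∧ inducedField 𝓘(ℝ, EM) (fun (h : G) (y : M) => h • y) μ x = 0} ⊆ interior V
  compact_V : IsCompact (closure V)
  closure_V : closure V ⊆ U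
  smooth : ContMDiffOn 𝓘(ℝ, EM) 𝓘(ℝ, ℝ) ∞ χ U
  invariant : ∀ (h : G), ∀ x ∈ U, χ (h • x) = χ x
  moment : IsKostantMomentOn B ρ (deformedConnection g nabla μ χ) U μχ
  proper : IsProperMap (fun x : U => μχ x)
  eq_on_V : ∀ x ∈ V, μχ x = μ x
  norm_le : ∀ x ∈ U, √(B (μ x) (μ x)) ≤ √(B (μχ x) (μχ x))
  zeros : ∀ x ∈ U, (inducedField 𝓘(ℝ, EM) (fun (h : G) (y : M) => h • y) μχ x = 0 ↔
    inducedField 𝓘(ℝ, EM) (fun (h : G) (y : M) => h • y) μ x = 0)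

end LineBundle

/-! ### The cylinder `M × N × [0,1]` -/

section Cylinder

/-- The diagonal action on `M × N × [0,1]`, trivial on `[0,1]`. -/
def cylinderAct {G : Type*} [Group G] {M N : Type*} [MulAction G M] [MulAction G N] (g : G)
    (w : M × N × Icc (0 : ℝ) 1) : M × N × Icc (0 : ℝ) 1 :=
  (g • w.1, g • w.2.1, w.2.2)

/-- The map `φ(m, n, t) = μχ(m) + η(t) μF(n)`. -/
def cylinderMap {𝔤 : Type*} [AddCommGroup 𝔤] [Module ℝ 𝔤] {M N : Type*} (μχ : M → 𝔤) (μF : N → 𝔤)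
    (η : ℝ → ℝ) (w : M × N × Icc (0 : ℝ) 1) : 𝔤 :=
  μχ w.1 + η w.2.2 • μF w.2.1

/-- The model with corners of `M × N × [0,1]`. -/
abbrev cylinderModel (EM EN : Type*) [NormedAddCommGroup EM] [NormedSpace ℝ EM]
    [NormedAddCommGroup EN] [NormedSpace ℝ EN] :=
  𝓘(ℝ, EM).prod (𝓘(ℝ, EN).prod (𝓡∂ 1))

end Cylinder

end PreQuant

end

open PreQuant

namespace PreQuant

/-! Suppose `X^φ` vanishes at `w = (m, n, t)` and put `ξ = φ(w)`. The action on the cylinder is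
diagonal, so `ξ^M` vanishes at `m`. Subtracting the Kostant formulas of the two connections gives
`⟨μχ, ξ⟩ = ⟨μE, ξ⟩ + χ g(X^μE, ξ^M)` on `U` (`kostantMoment_deformedConnection_apply`), and for this
`ξ` the last term drops out: `⟨μχ, μχ + η μF⟩ = ⟨μE, μχ + η μF⟩` at `w`. The left side grows
quadratically in `μχ(m)` and the right side at most linearly, since `μE` is bounded on the compact
closure of `U` and `μF` on the compact `N`. Hence `μχ(m)` stays in a fixed ball
(`exists_norm_le_of_apply_add_smul_eq`), and properness of `μχ` confines `m` to a compact subset of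
`U`. The zero set is moreover closed in `U × N × [0,1]`, because `ξ^M(x) = 0` is a closed condition
on `(ξ, x)` (`isClosed_setOf_actionField_eq_zero`). A closed subset of a compact set is compact. -/

/-- Every vector in a fibre of a smooth vector bundle is the value of a global smooth section. -/
theorem exists_contMDiff_section_eq
    {EM : Type*} [NormedAddCommGroup EM] [NormedSpace ℝ EM] [FiniteDimensional ℝ EM]
    {M : Type*} [TopologicalSpace M] [ChartedSpace EM M] [IsManifold 𝓘(ℝ, EM) ∞ M] [T2Space M]
    (F : Type*) [NormedAddCommGroup F] [NormedSpace ℝ F]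
    {E : M → Type*} [TopologicalSpace (TotalSpace F E)] [∀ x, AddCommGroup (E x)]
    [∀ x, Module ℝ (E x)] [∀ x, TopologicalSpace (E x)] [FiberBundle F E] [VectorBundle ℝ F E]
    [ContMDiffVectorBundle ∞ F E 𝓘(ℝ, EM)] {x : M} (v : E x) :
    ∃ s : Π y : M, E y, ContMDiff 𝓘(ℝ, EM) (𝓘(ℝ, EM).prod 𝓘(ℝ, F)) ∞
      (fun y => TotalSpace.mk' F y (s y)) ∧ s x = v := by
  -- The local extension is smooth only near `x`; a bump function supported there and equal to 1 at
  -- `x` makes it global.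
  obtain ⟨t, ht, hs⟩ := FiberBundle.exists_contMDiffOn_extend (k := ∞) 𝓘(ℝ, EM) F v
  obtain ⟨f, -, hf⟩ := (SmoothBumpFunction.nhds_basis_tsupport (I := 𝓘(ℝ, EM)) x).mem_iff.mp
    (interior_mem_nhds.mpr ht)
  exact ⟨(f : M → ℝ) • FiberBundle.extend F v,
    f.contMDiff.contMDiffOn.smul_section_of_tsupport isOpen_interior hf
      (hs.mono interior_subset), by simp⟩

/-! ### Continuity of the infinitesimal action -/

section Action

variable {EG : Type*} [NormedAddCommGroup EG] [NormedSpace ℝ EG]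
  {G : Type*} [TopologicalSpace G] [ChartedSpace EG G] [Group G]
  {EM : Type*} [NormedAddCommGroup EM] [NormedSpace ℝ EM]
  {M : Type*} [TopologicalSpace M] [ChartedSpace EM M]
  [MulAction G M] [ContMDiffSMul 𝓘(ℝ, EG) 𝓘(ℝ, EM) ∞ G M]

theorem contMDiff_orbit (x : M) :
    ContMDiff 𝓘(ℝ, EG) 𝓘(ℝ, EM) ∞ (fun g : G => g • x) :=
  contMDiff_id.smul contMDiff_const

/-- The pairs `(ξ, x)` for which the infinitesimal action of `ξ` vanishes at `x` form a closed
set. -/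
theorem isClosed_setOf_actionField_eq_zero [IsManifold 𝓘(ℝ, EG) ∞ G]
    [IsManifold 𝓘(ℝ, EM) ∞ M] :
    IsClosed {p : LieAlg EG G × M |
      actionField 𝓘(ℝ, EM) (fun (g : G) (y : M) => g • y) p.1 p.2 = 0} := by
  have : IsManifold 𝓘(ℝ, EG) 1 G := .of_le (n := ∞) (by simp)
  have : IsManifold 𝓘(ℝ, EM) 1 M := .of_le (n := ∞) (by simp)
  rw [← isOpen_compl_iff, isOpen_iff_mem_nhds]
  rintro ⟨ξ₀, x₀⟩ h₀
  have h₀' : mfderiv 𝓘(ℝ, EG) 𝓘(ℝ, EM) (fun g : G => g • x₀) 1 ξ₀ ≠ 0 := fun h =>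
    h₀ (neg_eq_zero.mpr h)
  have hsmooth : ContMDiffAt (𝓘(ℝ, EM).prod 𝓘(ℝ, EG)) 𝓘(ℝ, EM) ∞
      (Function.uncurry fun (x : M) (g : G) => g • x) (x₀, (1 : G)) :=
    (contMDiff_snd.smul contMDiff_fst).contMDiffAt
  -- Read in fixed tangent coordinates around `x₀`, the derivative at `1` of the orbit map of `x` is
  -- a continuous family `L x` of linear maps between fixed spaces.
  have hL := (hsmooth.mfderiv (m := 0) (fun (x : M) (g : G) => g • x) (fun _ : M => (1 : G))
    contMDiffAt_const (by simp)).continuousAt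
  set L := inTangentCoordinates 𝓘(ℝ, EG) 𝓘(ℝ, EM) (fun _ : M => (1 : G))
    (fun x : M => (1 : G) • x)
    (fun x => mfderiv 𝓘(ℝ, EG) 𝓘(ℝ, EM) (fun g : G => g • x) (1 : G)) x₀
  -- The source base point is always `1`, so only the coordinate change on the target side survives.
  -- The target base point is `1 • x`, not syntactically `x`.
  have hLeq : ∀ x : M, (1 : G) • x ∈ (chartAt EM ((1 : G) • x₀)).source → ∀ ξ : EG,
      L x ξ = (tangentBundleCore 𝓘(ℝ, EM) M).coordChange (achart EM ((1 : G) • x))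
        (achart EM ((1 : G) • x₀)) ((1 : G) • x)
        (mfderiv 𝓘(ℝ, EG) 𝓘(ℝ, EM) (fun g : G => g • x) (1 : G) ξ) := by
    intro x hx ξ
    have h := congrArg (fun A => A ξ) (inTangentCoordinates_eq (I := 𝓘(ℝ, EG)) (I' := 𝓘(ℝ, EM))
      (fun _ : M => (1 : G)) (fun x : M => (1 : G) • x)
      (fun x => mfderiv 𝓘(ℝ, EG) 𝓘(ℝ, EM) (fun g : G => g • x) (1 : G)) (x₀ := x₀)
      (mem_chart_source EG (1 : G)) hx)
    have hself := (tangentBundleCore 𝓘(ℝ, EG) G).coordChange_self (achart EG (1 : G)) 1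
      (mem_chart_source EG (1 : G)) ξ
    exact h.trans (congrArg (fun ζ : EG => (tangentBundleCore 𝓘(ℝ, EM) M).coordChange
      (achart EM ((1 : G) • x)) (achart EM ((1 : G) • x₀)) ((1 : G) • x)
      (mfderiv 𝓘(ℝ, EG) 𝓘(ℝ, EM) (fun g : G => g • x) (1 : G) ζ)) hself)
  -- At `x₀` the coordinate change is the identity.
  have hne : L x₀ ξ₀ ≠ 0 := fun h => h₀' <|
    ((tangentBundleCore 𝓘(ℝ, EM) M).coordChange_self (achart EM ((1 : G) • x₀)) ((1 : G) • x₀)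
      (mem_chart_source EM _) _).symm.trans ((hLeq x₀ (mem_chart_source EM _) ξ₀).symm.trans h)
  have hcont : ContinuousAt (fun p : EG × M => L p.2 p.1) (ξ₀, x₀) :=
    (ContinuousAt.comp (f := Prod.snd) (x := (ξ₀, x₀)) hL continuousAt_snd).clm_apply
      continuousAt_fst
  have hchart : ∀ᶠ p : EG × M in 𝓝 (ξ₀, x₀),
      (1 : G) • p.2 ∈ (chartAt EM ((1 : G) • x₀)).source := by
    simp only [one_smul]
    exact continuousAt_snd.eventually (chart_source_mem_nhds EM x₀)
  filter_upwards [hcont.eventually_ne hne, hchart] with p hp hpc h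
  -- Linearity of the coordinate change suffices: a vanishing derivative would force `L` to vanish.
  exact hp ((hLeq _ hpc _).trans ((congrArg _ (neg_eq_zero.mp h)).trans (map_zero _)))

end Action

/-! ### Infinitesimal action on the cylinder -/

section Cylinder

variable {EG : Type*} [NormedAddCommGroup EG] [NormedSpace ℝ EG]
  {G : Type*} [TopologicalSpace G] [ChartedSpace EG G] [Group G]
  {EM : Type*} [NormedAddCommGroup EM] [NormedSpace ℝ EM]
  {M : Type*} [TopologicalSpace M] [ChartedSpace EM M]
  [MulAction G M] [ContMDiffSMul 𝓘(ℝ, EG) 𝓘(ℝ, EM) ∞ G M]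
  {EN : Type*} [NormedAddCommGroup EN] [NormedSpace ℝ EN]
  {N : Type*} [TopologicalSpace N] [ChartedSpace EN N]
  [MulAction G N] [ContMDiffSMul 𝓘(ℝ, EG) 𝓘(ℝ, EN) ∞ G N]

/-- The infinitesimal action on the cylinder vanishes exactly where the infinitesimal actions on
both factors do. -/
theorem actionField_cylinderAct_eq_zero_iff (ξ : LieAlg EG G) (w : M × N × Icc (0 : ℝ) 1) :
    actionField (cylinderModel EM EN) (cylinderAct (G := G) (M := M) (N := N)) ξ w = 0 ↔
      actionField 𝓘(ℝ, EM) (fun (g : G) (y : M) => g • y) ξ w.1 = 0 ∧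
        actionField 𝓘(ℝ, EN) (fun (g : G) (y : N) => g • y) ξ w.2.1 = 0 := by
  have hM := (contMDiff_orbit (EG := EG) (G := G) (EM := EM) w.1).mdifferentiableAt
    (by simp) (x := 1) |>.hasMFDerivAt
  have hN := (contMDiff_orbit (EG := EG) (G := G) (EM := EN) w.2.1).mdifferentiableAt
    (by simp) (x := 1) |>.hasMFDerivAt
  -- The action on `[0,1]` is trivial, so the third component of the orbit map is constant and
  -- imposes no condition.
  have hI := hasMFDerivAt_const (I := 𝓘(ℝ, EG)) (I' := 𝓡∂ 1) w.2.2 (1 : G)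
  have key := (hM.prodMk (hN.prodMk hI)).mfderiv
  unfold actionField cylinderAct
  erw [key]
  constructor
  · intro h
    exact ⟨congrArg Prod.fst h, congrArg (fun p => p.2.1) h⟩
  · rintro ⟨h₁, h₂⟩
    exact Prod.ext h₁ (Prod.ext h₂ neg_zero)

end Cylinder

/-! ### Comparison of the two moment maps -/

section Moment

variable {EG : Type*} [NormedAddCommGroup EG] [NormedSpace ℝ EG]
  {G : Type*} [TopologicalSpace G] [ChartedSpace EG G] [Group G]
  {EM : Type*} [NormedAddCommGroup EM] [NormedSpace ℝ EM] [FiniteDimensional ℝ EM]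
  {M : Type*} [TopologicalSpace M] [ChartedSpace EM M] [IsManifold 𝓘(ℝ, EM) ∞ M] [T2Space M]
  [MulAction G M]
  {E : M → Type*} [TopologicalSpace (TotalSpace ℂ E)]
  [∀ x, NormedAddCommGroup (E x)] [∀ x, InnerProductSpace ℂ (E x)]
  [FiberBundle ℂ E] [VectorBundle ℝ ℂ E]
  [ContMDiffVectorBundle ∞ ℂ E 𝓘(ℝ, EM)]

/-- The moment map of the deformed connection:
`⟨μχ, ξ⟩ = ⟨μ, ξ⟩ + χ g(X^μ, ξ^M)`. -/
theorem kostantMoment_deformedConnection_apply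
    {B : LieAlg EG G →L[ℝ] LieAlg EG G →L[ℝ] ℝ}
    {g : ContMDiffRiemannianMetric 𝓘(ℝ, EM) ∞ EM (fun x : M => TangentSpace 𝓘(ℝ, EM) x)}
    {ρ : BundleAction EG G EM E} {nabla : CovariantDerivative 𝓘(ℝ, EM) ℂ E}
    {μ μχ : M → LieAlg EG G} {χ : M → ℝ} {U : Set M}
    (hμ : IsKostantMomentOn B ρ nabla univ μ)
    (hμχ : IsKostantMomentOn B ρ (deformedConnection g nabla μ χ) U μχ)
    (ξ : LieAlg EG G) {x : M} (hx : x ∈ U) :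
    B (μχ x) ξ = B (μ x) ξ +
      χ x * g.inner x (inducedField 𝓘(ℝ, EM) (fun (h : G) (y : M) => h • y) μ x)
        (actionField 𝓘(ℝ, EM) (fun (h : G) (y : M) => h • y) ξ x) := by
  -- The Kostant formula is an identity between multiples of `s x`; a section nonzero at `x` lets
  -- the scalars be compared.
  let e := (trivializationAt ℂ E x).continuousLinearEquivAt ℝ x
    (FiberBundle.mem_baseSet_trivializationAt' x)
  obtain ⟨s, hs, hsx⟩ := exists_contMDiff_section_eq (EM := EM) ℂ (e.symm 1)
  have hs0 : s x ≠ 0 := by simp [hsx]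
  have h₁ := hμ ξ s hs.contMDiffOn x (mem_univ x)
  have h₂ := hμχ ξ s hs.contMDiffOn x hx
  set r := g.inner x (inducedField 𝓘(ℝ, EM) (fun (h : G) (y : M) => h • y) μ x)
    (actionField 𝓘(ℝ, EM) (fun (h : G) (y : M) => h • y) ξ x) with hr
  have h₃ : deformedConnection g nabla μ χ s x
      (actionField 𝓘(ℝ, EM) (fun (h : G) (y : M) => h • y) ξ x) =
      nabla s x (actionField 𝓘(ℝ, EM) (fun (h : G) (y : M) => h • y) ξ x) +
        ((r : ℂ) * (2 * Real.pi * Complex.I * (χ x : ℂ))) • s x := by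
    rw [mul_smul, Complex.coe_smul]
    rfl
  -- Both formulas contain the same Lie derivative, so the undeformed one absorbs `nabla - 𝓛` and
  -- only the added one-form remains.
  rw [h₃, add_sub_right_comm, ← h₁, ← add_smul] at h₂
  have h₄ := smul_left_injective ℂ hs0 h₂
  have hpi : (2 * Real.pi * Complex.I : ℂ) ≠ 0 := Complex.two_pi_I_ne_zero
  have h₅ : ((B (μχ x) ξ : ℝ) : ℂ) = ((B (μ x) ξ + χ x * r : ℝ) : ℂ) := by
    apply mul_left_cancel₀ hpi
    push_cast
    rw [h₄]
    ring
  exact_mod_cast h₅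

end Moment

/-! ### Quadratic versus linear growth -/

section Bound

/-- A positive definite continuous bilinear form on a finite-dimensional space is coercive. -/
theorem exists_pos_mul_sq_norm_le {W : Type*} [NormedAddCommGroup W] [NormedSpace ℝ W]
    [FiniteDimensional ℝ W] (B : W →L[ℝ] W →L[ℝ] ℝ) (hB : ∀ v, v ≠ 0 → 0 < B v v) :
    ∃ c > 0, ∀ v, c * ‖v‖ ^ 2 ≤ B v v := by
  have hcont : Continuous fun v => B v v := by fun_prop
  rcases (Metric.sphere (0 : W) 1).eq_empty_or_nonempty with h | h
  · refine ⟨1, one_pos, fun v => ?_⟩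
    have hv : v = 0 := by
      by_contra hv
      have : ‖v‖⁻¹ • v ∈ Metric.sphere (0 : W) 1 := by
        simp [norm_smul, inv_mul_cancel₀ (norm_ne_zero_iff.mpr hv)]
      simp [h] at this
    simp [hv]
  -- The constant is the minimum of `B v v` on the compact unit sphere; homogeneity of degree two
  -- does the rest.
  · obtain ⟨u, hu, hmin⟩ := (isCompact_sphere (0 : W) 1).exists_isMinOn h hcont.continuousOn
    refine ⟨B u u, hB u (ne_zero_of_mem_unit_sphere ⟨u, hu⟩), fun v => ?_⟩
    by_cases hv : v = 0
    · simp [hv]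
    have hn : ‖v‖ ≠ 0 := norm_ne_zero_iff.mpr hv
    have hmem : ‖v‖⁻¹ • v ∈ Metric.sphere (0 : W) 1 := by
      simp [norm_smul, inv_mul_cancel₀ hn]
    have := isMinOn_iff.mp hmin _ hmem
    simp only [map_smul, _root_.smul_apply, smul_eq_mul] at this
    calc B u u * ‖v‖ ^ 2 ≤ (‖v‖⁻¹ * (‖v‖⁻¹ * B v v)) * ‖v‖ ^ 2 := by gcongr
      _ = B v v := by field_simp

/-- If `⟨a, a + t b⟩ = ⟨m, a + t b⟩` with `t ∈ [0,1]` and `m`, `b` bounded, then `a` is bounded. -/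
theorem exists_norm_le_of_apply_add_smul_eq {W : Type*} [NormedAddCommGroup W] [NormedSpace ℝ W]
    [FiniteDimensional ℝ W] (B : W →L[ℝ] W →L[ℝ] ℝ) (hB : ∀ v, v ≠ 0 → 0 < B v v) (D C : ℝ) :
    ∃ R, ∀ (a b m : W) (t : ℝ), t ∈ Icc (0 : ℝ) 1 → ‖m‖ ≤ D → ‖b‖ ≤ C →
      B a (a + t • b) = B m (a + t • b) → ‖a‖ ≤ R := by
  obtain ⟨c, hc, hcoer⟩ := exists_pos_mul_sq_norm_le B hB
  -- Expanding, `B a a = B m a + t B m b - t B a b ≤ ‖B‖ (D ‖a‖ + D C + C ‖a‖)`. When `‖a‖ ≥ 1` the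
  -- constant term `D C` is at most `D C ‖a‖`, and dividing by `c ‖a‖` gives the second entry; the
  -- entry 1 covers `‖a‖ ≤ 1`.
  refine ⟨max 1 (‖B‖ * (D + C + D * C) / c), fun a b m t ht hm hb h => ?_⟩
  rcases le_total ‖a‖ 1 with ha | ha
  · exact ha.trans (le_max_left _ _)
  refine le_max_of_le_right ?_
  have hD : 0 ≤ D := (norm_nonneg m).trans hm
  have hC : 0 ≤ C := (norm_nonneg b).trans hb
  have bound (v w : W) : |B v w| ≤ ‖B‖ * ‖v‖ * ‖w‖ := B.le_opNorm₂ v w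
  have h₁ : B m a ≤ ‖B‖ * D * ‖a‖ :=
    (le_abs_self _).trans ((bound m a).trans (by gcongr))
  have h₂ : t * B m b ≤ ‖B‖ * D * C := by
    have : |t * B m b| ≤ 1 * (‖B‖ * D * C) := by
      rw [abs_mul, abs_of_nonneg ht.1]
      exact mul_le_mul ht.2 ((bound m b).trans (by gcongr)) (abs_nonneg _) zero_le_one
    linarith [le_abs_self (t * B m b)]
  have h₃ : -(t * B a b) ≤ ‖B‖ * ‖a‖ * C := by
    have : |t * B a b| ≤ 1 * (‖B‖ * ‖a‖ * C) := by
      rw [abs_mul, abs_of_nonneg ht.1]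
      exact mul_le_mul ht.2 ((bound a b).trans (by gcongr)) (abs_nonneg _) zero_le_one
    linarith [neg_abs_le (t * B a b)]
  simp only [map_add, map_smul, smul_eq_mul] at h
  have h₄ : ‖B‖ * D * C ≤ ‖B‖ * D * C * ‖a‖ := le_mul_of_one_le_right (by positivity) ha
  have h₅ : c * ‖a‖ * ‖a‖ ≤ ‖B‖ * (D + C + D * C) * ‖a‖ := by
    linarith [hcoer a, sq ‖a‖]
  rw [le_div_iff₀ hc, mul_comm]
  exact le_of_mul_le_mul_right h₅ (by linarith)

end Bound

end PreQuant

/-! ### Compactness of the zero set -/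

theorem lemma5p1
    -- `G` is a compact, connected Lie group with an `Ad`-invariant inner product on its Lie algebra
    {EG : Type*} [NormedAddCommGroup EG] [NormedSpace ℝ EG] [FiniteDimensional ℝ EG]
    {G : Type*} [TopologicalSpace G] [ChartedSpace EG G] [Group G] [LieGroup 𝓘(ℝ, EG) ∞ G]
    [T2Space G] [CompactSpace G] [ConnectedSpace G]
    (B : LieAlg EG G →L[ℝ] LieAlg EG G →L[ℝ] ℝ) (hB : IsAdInvariantInner B)
    -- `M` is a Hamiltonian `G`-space with pre-quantum line bundle `E`
    {EM : Type*} [NormedAddCommGroup EM] [NormedSpace ℝ EM] [FiniteDimensional ℝ EM]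
    {M : Type*} [TopologicalSpace M] [ChartedSpace EM M] [IsManifold 𝓘(ℝ, EM) ∞ M]
    [T2Space M] [SecondCountableTopology M]
    [MulAction G M] [ContMDiffSMul 𝓘(ℝ, EG) 𝓘(ℝ, EM) ∞ G M]
    (ωM : Π x : M, TangentSpace 𝓘(ℝ, EM) x →L[ℝ] TangentSpace 𝓘(ℝ, EM) x →L[ℝ] ℝ)
    (μE : M → LieAlg EG G) (hM : IsHamiltonian B ωM μE)
    (J : Π x : M, TangentSpace 𝓘(ℝ, EM) x →L[ℝ] TangentSpace 𝓘(ℝ, EM) x)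
    (gM : ContMDiffRiemannianMetric 𝓘(ℝ, EM) ∞ EM (fun x : M => TangentSpace 𝓘(ℝ, EM) x))
    (hJ : IsCompatible G ωM J gM)
    {E : M → Type*} [TopologicalSpace (TotalSpace ℂ E)]
    [∀ x, NormedAddCommGroup (E x)] [∀ x, InnerProductSpace ℂ (E x)]
    [FiberBundle ℂ E] [VectorBundle ℂ ℂ E] [VectorBundle ℝ ℂ E]
    [ContMDiffVectorBundle ∞ ℂ E 𝓘(ℝ, EM)]
    (ρE : BundleAction EG G EM E) (nablaE : CovariantDerivative 𝓘(ℝ, EM) ℂ E)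
    (hE : IsPrequantum ωM ρE nablaE) (hμE : IsKostantMomentOn B ρE nablaE univ μE)
    -- `N` is a compact Hamiltonian `G`-space with pre-quantum line bundle `F`
    {EN : Type*} [NormedAddCommGroup EN] [NormedSpace ℝ EN] [FiniteDimensional ℝ EN]
    {N : Type*} [TopologicalSpace N] [ChartedSpace EN N] [IsManifold 𝓘(ℝ, EN) ∞ N]
    [T2Space N] [CompactSpace N]
    [MulAction G N] [ContMDiffSMul 𝓘(ℝ, EG) 𝓘(ℝ, EN) ∞ G N]
    (ωN : Π x : N, TangentSpace 𝓘(ℝ, EN) x →L[ℝ] TangentSpace 𝓘(ℝ, EN) x →L[ℝ] ℝ)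
    (μF : N → LieAlg EG G) (hN : IsHamiltonian B ωN μF)
    {F : N → Type*} [TopologicalSpace (TotalSpace ℂ F)]
    [∀ x, NormedAddCommGroup (F x)] [∀ x, InnerProductSpace ℂ (F x)]
    [FiberBundle ℂ F] [VectorBundle ℂ ℂ F] [VectorBundle ℝ ℂ F]
    [ContMDiffVectorBundle ∞ ℂ F 𝓘(ℝ, EN)]
    (ρF : BundleAction EG G EN F) (nablaF : CovariantDerivative 𝓘(ℝ, EN) ℂ F)
    (hF : IsPrequantum ωN ρF nablaF) (hμF : IsKostantMomentOn B ρF nablaF univ μF)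
    -- `U` is an invariant, open, relatively compact subset of `M` over which `μE` is taming
    (U : Set M) (hUo : IsOpen U) (hUi : IsInvariantSet G U) (hUc : IsCompact (closure U))
    (hUt : IsTamingOn 𝓘(ℝ, EM) (fun (g : G) (x : M) => g • x) μE U)
    -- the choice of `V`, of `χ`, and the resulting proper moment map `μχ` on `U`
    (V : Set M) (χ : M → ℝ) (μχ : M → LieAlg EG G)
    (hχ : IsProperDeformation B gM ρE nablaE μE U V χ μχ)
    -- the cutoff function `η`
    (η : ℝ → ℝ) (hη : ContDiff ℝ ∞ η) (hη01 : ∀ t, η t ∈ Icc (0 : ℝ) 1)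
    (hη0 : ∀ t, t ≤ 1 / 3 → η t = 0) (hη1 : ∀ t, 2 / 3 ≤ t → η t = 1) :
    IsTamingOn (cylinderModel EM EN) (cylinderAct (G := G) (M := M) (N := N))
      (cylinderMap μχ μF η) (U ×ˢ univ) := by
  have hcont : Continuous fun x : U => μχ x := hχ.proper.continuous
  have hμEc : Continuous μE := hM.smooth.continuous
  have hμFc : Continuous μF := hN.smooth.continuous
  obtain ⟨D, hD⟩ := hUc.exists_bound_of_continuousOn (E := EG) (f := μE) hμEc.continuousOn
  obtain ⟨C, hC⟩ := isCompact_univ.exists_bound_of_continuousOn (E := EG) (f := μF)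
    hμFc.continuousOn
  obtain ⟨R, hR⟩ := exists_norm_le_of_apply_add_smul_eq (W := EG) B hB.pos D C
  let K : Set (LieAlg EG G) := Metric.closedBall (α := EG) 0 R
  have hK : IsCompact ((fun x : U => μχ x) ⁻¹' K) :=
    hχ.proper.isCompact_preimage (isCompact_closedBall (0 : EG) R)
  -- Continuity and properness of `μχ` are available only on the subtype `U`, so compactness is
  -- proved there and carried to `M × N × [0,1]` by the continuous map `ι`.
  let ι : U × N × Icc (0 : ℝ) 1 → M × N × Icc (0 : ℝ) 1 := fun w => (w.1, w.2)
  have hι : Continuous ι := by fun_prop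
  have hφ : Continuous fun w : U × N × Icc (0 : ℝ) 1 => cylinderMap μχ μF η (ι w) :=
    (hcont.comp continuous_fst).add (Continuous.smul (M := ℝ) (X := EG)
      (hη.continuous.comp (continuous_subtype_val.comp (continuous_snd.comp continuous_snd)))
      (hμFc.comp (continuous_fst.comp continuous_snd)))
  have hclosed : IsClosed {w : U × N × Icc (0 : ℝ) 1 |
      inducedField (cylinderModel EM EN) (cylinderAct (G := G)) (cylinderMap μχ μF η) (ι w) = 0} := by
    simp only [inducedField, actionField_cylinderAct_eq_zero_iff, ofPred_and]
    exact ((isClosed_setOf_actionField_eq_zero (EM := EM) (M := M)).preimage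
      (hφ.prodMk (continuous_fst.comp hι))).inter
      ((isClosed_setOf_actionField_eq_zero (EM := EN) (M := N)).preimage
        (hφ.prodMk (continuous_fst.comp (continuous_snd.comp hι))))
  have hsub : {w : U × N × Icc (0 : ℝ) 1 |
      inducedField (cylinderModel EM EN) (cylinderAct (G := G)) (cylinderMap μχ μF η) (ι w) = 0} ⊆
      ((fun x : U => μχ x) ⁻¹' K) ×ˢ univ := by
    rintro ⟨x, n, t⟩ hw
    have hx := ((actionField_cylinderAct_eq_zero_iff _ _).mp hw).1
    -- The comparison is tested against `ξ = φ(w)` itself, whose field vanishes at `x` by `hx`; this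
    -- kills the term with `χ`.
    have hmom := kostantMoment_deformedConnection_apply hμE hχ.moment
      (cylinderMap μχ μF η (ι (x, n, t))) x.2
    rw [hx, map_zero, mul_zero, add_zero] at hmom
    refine ⟨?_, mem_univ _⟩
    refine (mem_closedBall_zero_iff (E := EG)).mpr ?_
    -- Here `a = μχ x`, `b = μF n`, `m = μE x`, and the scalar in `[0,1]` is `η t`.
    exact hR _ _ _ _ (hη01 t) (hD _ (subset_closure x.2))
      (hC _ (mem_univ n)) hmom
  have himage : {w | w ∈ U ×ˢ univ ∧ inducedField (cylinderModel EM EN)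
      (cylinderAct (G := G)) (cylinderMap μχ μF η) w = 0} = ι '' {w | inducedField
      (cylinderModel EM EN) (cylinderAct (G := G)) (cylinderMap μχ μF η) (ι w) = 0} := by
    ext w
    constructor
    · rintro ⟨⟨hw, -⟩, h⟩
      exact ⟨(⟨w.1, hw⟩, w.2), h, rfl⟩
    · rintro ⟨v, hv, rfl⟩
      exact ⟨⟨v.1.2, mem_univ _⟩, hv⟩
  rw [IsTamingOn, himage]
  exact ((hK.prod isCompact_univ).of_isClosed_subset hclosed hsub).image hι
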